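/- Let $n\ge 0$, let $C$ and $E$ be finite sets, let $\mathcal D\subseteq C^n$, $f:\mathcal D\to E$, and let $s\in[0,\infty)^n$ be a vector of nonnegative costs. An adversary matrix for $f$ is a nonzero real symmetric matrix $\Gamma$, with rows and columns indexed by $\mathcal D$, such that $\langle x|\Gamma|y\rangle=0$ whenever $f(x)=f(y)$. For $j\in[n]=\{1,\dots,n\}$ let $\Delta_j$ be the $\mathcal D\times\mathcal D$ matrix whose $(x,y)$ entry is $1$ if $x_j\ne y_j$ and $0$ otherwise, let $\circ$ denote the entry-wise product and $\|\cdot\|$ the operator norm. The general adversary bound with costs $s$ is $$\mathrm{ADV}^\pm_s(f)=\max\bigl\{\|\Gamma\| : \Gamma \text{ an adversary matrix for } f,\ \|\Gamma\circ\Delta_j\|\le s_j \text{ for all } j\in[n]\bigr\},$$ where a maximum over the empty set is understood to be $0$ (otherwise this maximum is attained). If $|C|=2$ or $|E|=2$, then $$\mathrm{ADV}^\pm_s(f)=\min_{X}\ \max_{x\in\mathcal D}\ \sum_{j\in[n]} s_j\,\langle x,j|X|x,j\rangle ,$$ where $X$ ranges over the positive semidefinite matrices with rows and columns indexed by $\mathcal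 D\times[n]$ such that $$\sum_{j\in[n]:\,x_j\ne y_j}\langle x,j|X|y,j\rangle=1\qquad\text{for all } x,y\in\mathcal D \text{ with } f(x)\ne f(y),$$ and the minimum is attained. This holds both for real symmetric and for complex Hermitian positive semidefinite matrices $X$. -/

import Mathlib

open scoped ComplexOrder

noncomputable section

/-- An adversary matrix for `f : D → E`, where `D ⊆ Cⁿ` is finite: a nonzero real symmetric matrix
indexed by `D` whose `(x, y)` entry vanishes whenever `f x = f y`. -/
def IsAdversaryMatrix {n : ℕ} {C E : Type*} {D : Finset (Fin n → C)} (f : D → E)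
    (Γ : Matrix D D ℝ) : Prop :=
  Γ ≠ 0 ∧ Γ.IsSymm ∧ ∀ x y : D, f x = f y → Γ x y = 0

/-- The 0-1 matrix `Δ_j`, with a one at `(x, y)` exactly when `x_j ≠ y_j`. -/
def deltaMatrix {n : ℕ} {C : Type*} [DecidableEq C] (D : Finset (Fin n → C)) (j : Fin n) :
    Matrix D D ℝ :=
  Matrix.of fun x y => if x.1 j ≠ y.1 j then 1 else 0

/-- The operator norm (with respect to Euclidean norms) of a real square matrix indexed by `D`. -/
def matrixOpNorm {n : ℕ} {C : Type*} [DecidableEq C] {D : Finset (Fin n → C)}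
    (Γ : Matrix D D ℝ) : ℝ :=
  ‖Matrix.toEuclideanCLM (n := D) (𝕜 := ℝ) Γ‖

/-- The set of the values `‖Γ‖`, for `Γ` an adversary matrix with `‖Γ ∘ Δ_j‖ ≤ s_j` for all `j`,
where `∘` is the entry-wise product. -/
def advPMValues {n : ℕ} {C E : Type*} [DecidableEq C] {D : Finset (Fin n → C)} (f : D → E)
    (s : Fin n → ℝ) : Set ℝ :=
  {r | ∃ Γ : Matrix D D ℝ, IsAdversaryMatrix f Γ ∧
    (∀ j, matrixOpNorm (Matrix.hadamard Γ (deltaMatrix D j)) ≤ s j) ∧ r = matrixOpNorm Γ}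

/-- The general adversary bound with costs `s`: the maximum of `advPMValues f s`. It is `0` if no
adversary matrix satisfies the constraints (for instance if `f` is constant, or `s = 0`). -/
def advPM {n : ℕ} {C E : Type*} [DecidableEq C] {D : Finset (Fin n → C)} (f : D → E)
    (s : Fin n → ℝ) : ℝ :=
  sSup (advPMValues f s)

/-- Feasibility in the dual semidefinite program: `X ⪰ 0`, with coordinates labelled by `D × [n]`,
and `∑_{j : x_j ≠ y_j} ⟨x,j|X|y,j⟩ = 1` whenever `f x ≠ f y`. -/
def IsDualFeasible {n : ℕ} {C E : Type*} [DecidableEq C] {D : Finset (Fin n → C)} {𝕜 : Type*}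
    [RCLike 𝕜] (f : D → E) (X : Matrix (D × Fin n) (D × Fin n) 𝕜) : Prop :=
  X.PosSemidef ∧
    ∀ x y : D, f x ≠ f y → ∑ j : Fin n with x.1 j ≠ y.1 j, X (x, j) (y, j) = 1

/-- The objective `max_{x ∈ D} ∑_j s_j ⟨x,j|X|x,j⟩`. The diagonal entries of a positive
semidefinite matrix are real, so taking real parts loses nothing. -/
def dualObjective {n : ℕ} {C : Type*} {D : Finset (Fin n → C)} {𝕜 : Type*} [RCLike 𝕜]
    (s : Fin n → ℝ) (X : Matrix (D × Fin n) (D × Fin n) 𝕜) : ℝ :=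
  ⨆ x : D, ∑ j : Fin n, s j * RCLike.re (X (x, j) (x, j))

end

/-! This is semidefinite duality. Let `X_j` be the diagonal block of `X` at `j`. The dual constraint
gives `Γ = ∑_j (Γ ∘ Δ_j) ∘ X_j`. With `X` written as a Gram matrix, the quadratic form of `Γ` splits
into forms of the `Γ ∘ Δ_j`, each controlled by `s_j`. This is weak duality
(`opNorm_le_dualObjective_real`), valid for arbitrary alphabets.

Conversely, only the diagonal blocks matter. If none achieve the value `t`, separation
(`exists_psd_or_exists_certificate`) yields, after symmetrization, a matrix `Γ` and weights `β ≥ 0`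
with `Γ ∘ Δ_j ⪯ s_j diag β` and `t ∑ β < ∑ Γ`. Scaling `Γ` by `β^(-1/2)` on both sides gives a
matrix of norm above `t`. The bounds are one-sided, whereas a norm bound needs both sides. In the
binary case `Γ ∘ Δ_j` is supported on a bipartite graph, so conjugation by a diagonal sign matrix
negates it and the missing side follows (`exists_isPrimalFeasible_of_certificate`).

Separation needs a closed cone, which positive costs guarantee. Zero-cost blocks are split off: they
meet for free every constraint on a pair differing at a zero-cost coordinate
(`exists_isDualFeasible_extension`). -/

section QuadraticForms

/-! ### Quadratic forms and operator norms of real matrices -/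

variable {α : Type*} [Fintype α]

lemma dotProduct_mulVec_eq_sum (M : Matrix α α ℝ) (v : α → ℝ) :
    v ⬝ᵥ M.mulVec v = ∑ x, ∑ y, M x y * (v x * v y) := by
  simp only [dotProduct, Matrix.mulVec, Finset.mul_sum]
  exact Finset.sum_congr rfl fun x _ => Finset.sum_congr rfl fun y _ => by ring

lemma posSemidef_real_iff (M : Matrix α α ℝ) :
    M.PosSemidef ↔ M.IsSymm ∧ ∀ v : α → ℝ, 0 ≤ ∑ x, ∑ y, M x y * (v x * v y) := by
  rw [Matrix.posSemidef_iff_dotProduct_mulVec]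
  simp [Matrix.IsHermitian, Matrix.conjTranspose_eq_transpose_of_trivial, Matrix.IsSymm,
    dotProduct_mulVec_eq_sum]

variable [DecidableEq α]

lemma abs_quadForm_le_opNorm (M : Matrix α α ℝ) (v : α → ℝ) :
    |∑ x, ∑ y, M x y * (v x * v y)| ≤
      ‖Matrix.toEuclideanCLM (n := α) (𝕜 := ℝ) M‖ * ∑ x, v x ^ 2 := by
  set T := Matrix.toEuclideanCLM (n := α) (𝕜 := ℝ) M
  set w : EuclideanSpace ℝ α := WithLp.toLp 2 v
  have h1 : inner ℝ w (T w) = ∑ x, ∑ y, M x y * (v x * v y) := by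
    rw [Matrix.inner_toEuclideanCLM, ← dotProduct_mulVec_eq_sum]
  have h2 : ‖w‖ * ‖w‖ = ∑ x, v x ^ 2 := by
    rw [← sq, EuclideanSpace.real_norm_sq_eq]
  rw [← h1, ← h2]
  calc |inner ℝ w (T w)| ≤ ‖w‖ * ‖T w‖ := abs_real_inner_le_norm _ _
    _ ≤ ‖w‖ * (‖T‖ * ‖w‖) := by gcongr; exact T.le_opNorm w
    _ = _ := by ring

lemma opNorm_le_of_abs_quadForm_le (M : Matrix α α ℝ) (hM : M.IsSymm) (c : ℝ) (hc : 0 ≤ c)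
    (h : ∀ v : α → ℝ, |∑ x, ∑ y, M x y * (v x * v y)| ≤ c * ∑ x, v x ^ 2) :
    ‖Matrix.toEuclideanCLM (n := α) (𝕜 := ℝ) M‖ ≤ c := by
  set T := Matrix.toEuclideanCLM (n := α) (𝕜 := ℝ) M with hT
  have hs : T.IsSymmetric := by
    intro v w
    change inner ℝ (T v) w = inner ℝ v (T w)
    rw [real_inner_comm, Matrix.inner_toEuclideanCLM, Matrix.inner_toEuclideanCLM,
      Matrix.dotProduct_mulVec, ← Matrix.mulVec_transpose, hM.eq, dotProduct_comm]
  rw [ContinuousLinearMap.norm_eq_iSup_rayleighQuotient T hs]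
  refine Real.iSup_le (fun w => ?_) hc
  have h1 : T.reApplyInnerSelf w = ∑ x, ∑ y, M x y * (w x * w y) := by
    rw [ContinuousLinearMap.reApplyInnerSelf_apply, real_inner_comm, Matrix.inner_toEuclideanCLM,
      dotProduct_mulVec_eq_sum]
    rfl
  have h2 : ‖w‖ ^ 2 = ∑ x, w x ^ 2 := EuclideanSpace.real_norm_sq_eq w
  rw [ContinuousLinearMap.rayleighQuotient, h1, abs_div, abs_of_nonneg (sq_nonneg ‖w‖)]
  refine div_le_of_le_mul₀ (sq_nonneg _) hc ?_
  rw [h2]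
  exact h w

lemma abs_apply_le_opNorm (M : Matrix α α ℝ) (x y : α) :
    |M x y| ≤ ‖Matrix.toEuclideanCLM (n := α) (𝕜 := ℝ) M‖ := by
  set T := Matrix.toEuclideanCLM (n := α) (𝕜 := ℝ) M
  have h : inner ℝ (EuclideanSpace.single x (1 : ℝ)) (T (EuclideanSpace.single y (1 : ℝ)))
      = M x y := by
    rw [Matrix.inner_toEuclideanCLM]
    simp [EuclideanSpace.single]
  rw [← h]
  refine (abs_real_inner_le_norm _ _).trans ?_
  simpa using T.le_opNorm (EuclideanSpace.single y (1 : ℝ))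

lemma quadForm_single_add_single (M : Matrix α α ℝ) (hM : M.IsSymm) {x y : α} (a b : ℝ) :
    ∑ z, ∑ w, M z w * ((Pi.single x a + Pi.single y b : α → ℝ) z *
      (Pi.single x a + Pi.single y b : α → ℝ) w) =
      M x x * a ^ 2 + 2 * M x y * (a * b) + M y y * b ^ 2 := by
  rw [← dotProduct_mulVec_eq_sum]
  have := hM.apply x y
  simp [Matrix.mulVec_add, add_dotProduct, dotProduct_add, Matrix.col_apply]
  rw [this]
  ring

/-- Testing on `e_x ± e_y` gives `2 |M x y| ≤ M x x + M y y`. -/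
lemma Matrix.PosSemidef.abs_apply_le {M : Matrix α α ℝ} (hM : M.PosSemidef) {c : ℝ} (x y : α)
    (hx : M x x ≤ c) (hy : M y y ≤ c) : |M x y| ≤ c := by
  obtain ⟨hs, hp⟩ := (posSemidef_real_iff M).1 hM
  have h1 := hp (Pi.single x 1 + Pi.single y 1)
  have h2 := hp (Pi.single x 1 + Pi.single y (-1))
  rw [quadForm_single_add_single M hs] at h1 h2
  rw [abs_le]
  constructor <;> linarith

end QuadraticForms

/-! ### Separation and a theorem of alternatives -/

section Duality

variable {α ι : Type*} [Fintype α]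

/-- A continuous map on a proper space sends a closed set on which it is bounded below to a
closed set. -/
lemma isClosed_image_of_norm_le {V W : Type*} [NormedAddCommGroup V] [ProperSpace V]
    [NormedAddCommGroup W] (L : V → W) (hL : Continuous L) (P : Set V) (hP : IsClosed P)
    (c : ℝ) (hc0 : 0 ≤ c) (hc : ∀ X ∈ P, ‖X‖ ≤ c * ‖L X‖) : IsClosed (L '' P) := by
  refine isClosed_of_closure_subset fun z hz => ?_
  have hK : IsCompact (L '' (P ∩ Metric.closedBall 0 (c * (‖z‖ + 1)))) :=
    (((isCompact_closedBall _ _).inter_left hP)).image hL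
  have h1 : z ∈ closure (Metric.ball z 1 ∩ L '' P) :=
    Metric.isOpen_ball.inter_closure ⟨Metric.mem_ball_self one_pos, hz⟩
  have h2 : Metric.ball z 1 ∩ L '' P ⊆ L '' (P ∩ Metric.closedBall 0 (c * (‖z‖ + 1))) := by
    rintro _ ⟨hb, X, hX, rfl⟩
    refine ⟨X, ⟨hX, ?_⟩, rfl⟩
    rw [mem_closedBall_zero_iff]
    refine (hc X hX).trans (mul_le_mul_of_nonneg_left ?_ hc0)
    have := norm_le_norm_add_norm_sub' (L X) z
    rw [mem_ball_iff_norm] at hb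
    linarith
  obtain ⟨X, ⟨hX, -⟩, h⟩ := closure_minimal h2 hK.isClosed h1
  exact ⟨X, hX, h⟩

/-- The cone of families of positive semidefinite matrices together with nonnegative vectors. -/
def psdCone (α ι : Type*) [Fintype α] : Set ((ι → α → α → ℝ) × (α → ℝ)) :=
  {p | (∀ j, (Matrix.of (p.1 j)).PosSemidef) ∧ ∀ x, 0 ≤ p.2 x}

lemma isClosed_psdCone : IsClosed (psdCone α ι) := by
  have : psdCone α ι = {p | (∀ j, (∀ x y, p.1 j y x = p.1 j x y) ∧
      ∀ v : α → ℝ, 0 ≤ ∑ x, ∑ y, p.1 j x y * (v x * v y)) ∧ ∀ x, 0 ≤ p.2 x} := by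
    ext p
    simp [psdCone, posSemidef_real_iff, Matrix.IsSymm.ext_iff]
  rw [this]
  simp only [Set.ofPred_and, Set.ofPred_forall]
  refine (isClosed_iInter fun j => (isClosed_iInter fun x => isClosed_iInter fun y =>
    isClosed_eq (by fun_prop) (by fun_prop)).inter (isClosed_iInter fun v =>
    isClosed_le (by fun_prop) (by fun_prop))).inter
    (isClosed_iInter fun x => isClosed_le (by fun_prop) (by fun_prop))

lemma smul_mem_psdCone {p : (ι → α → α → ℝ) × (α → ℝ)} (hp : p ∈ psdCone α ι) {a : ℝ}
    (ha : 0 ≤ a) : a • p ∈ psdCone α ι :=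
  ⟨fun j => (hp.1 j).smul ha, fun x => mul_nonneg ha (hp.2 x)⟩

lemma convex_psdCone : Convex ℝ (psdCone α ι) := by
  intro p hp q hq a b ha hb _
  have h1 := smul_mem_psdCone hp ha
  have h2 := smul_mem_psdCone hq hb
  exact ⟨fun j => (h1.1 j).add (h2.1 j), fun x => add_nonneg (h1.2 x) (h2.2 x)⟩

variable [Fintype ι]

/-- The constraint map of the semidefinite program: the linear equations and the upper bounds. -/
def constraintMap (A : ι → α → α → ℝ) (s : ι → ℝ) :
    ((ι → α → α → ℝ) × (α → ℝ)) →ₗ[ℝ] ((α × α) ⊕ α → ℝ) where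
  toFun p := Sum.elim (fun q => ∑ j, A j q.1 q.2 * p.1 j q.1 q.2)
    (fun x => ∑ j, s j * p.1 j x x + p.2 x)
  map_add' p q := by
    ext (i | x)
    · simp [mul_add, Finset.sum_add_distrib]
    · simp [mul_add, Finset.sum_add_distrib]; ring
  map_smul' a p := by
    ext (i | x)
    · simp [Finset.mul_sum, mul_left_comm]
    · simp [Finset.mul_sum, mul_left_comm, mul_add]

/-- Positive costs let the upper bounds control the diagonals and slacks, and the diagonals control
all entries of positive semidefinite matrices. Hence the norm on the cone is bounded by a multiple
of the norm of the image. -/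
lemma isClosed_image_constraintMap (A : ι → α → α → ℝ) (s : ι → ℝ) (hs : ∀ j, 0 < s j) :
    IsClosed (constraintMap A s '' psdCone α ι) := by
  classical
  have hpos : ∀ j, 0 ≤ 1 / s j := fun j => (one_div_pos.2 (hs j)).le
  refine isClosed_image_of_norm_le _ (constraintMap A s).continuous_of_finiteDimensional _
    isClosed_psdCone (∑ j, 1 / s j + 1) (add_nonneg (Finset.sum_nonneg fun j _ => hpos j)
    zero_le_one) fun p hp => ?_
  set N := ‖constraintMap A s p‖ with hN
  have hN0 : 0 ≤ N := norm_nonneg _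
  have hd : ∀ j x, 0 ≤ p.1 j x x := fun j x => (hp.1 j).diag_nonneg (i := x)
  have hb : ∀ x, ∑ j, s j * p.1 j x x + p.2 x ≤ N := fun x =>
    (le_abs_self _).trans (norm_le_pi_norm (constraintMap A s p) (Sum.inr x))
  have hterm : ∀ x j, 0 ≤ s j * p.1 j x x := fun x j => mul_nonneg (hs j).le (hd j x)
  have hdb : ∀ j x, p.1 j x x ≤ 1 / s j * N := fun j x => by
    have h1 := Finset.single_le_sum (fun j _ => hterm x j) (Finset.mem_univ j)
    have h2 := hb x
    have h3 := hp.2 x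
    rw [one_div, ← div_eq_inv_mul, le_div_iff₀ (hs j)]
    linarith
  have hj : ∀ j, 1 / s j * N ≤ (∑ j, 1 / s j + 1) * N := fun j =>
    mul_le_mul_of_nonneg_right ((Finset.single_le_sum (fun j _ => hpos j)
      (Finset.mem_univ j)).trans (by linarith)) hN0
  have hR : 0 ≤ (∑ j, 1 / s j + 1) * N := by
    have := Finset.sum_nonneg fun j (_ : j ∈ Finset.univ) => hpos j
    positivity
  refine norm_prod_le_iff.2 ⟨?_, ?_⟩
  · refine (pi_norm_le_iff_of_nonneg hR).2 fun j => (pi_norm_le_iff_of_nonneg hR).2 fun x =>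
      (pi_norm_le_iff_of_nonneg hR).2 fun y => ?_
    exact ((hp.1 j).abs_apply_le x y (hdb j x) (hdb j y)).trans (hj j)
  · refine (pi_norm_le_iff_of_nonneg hR).2 fun x => ?_
    rw [Real.norm_eq_abs, abs_of_nonneg (hp.2 x)]
    have h1 := Finset.sum_nonneg fun j (_ : j ∈ Finset.univ) => hterm x j
    have h2 := Finset.sum_nonneg fun j (_ : j ∈ Finset.univ) => hpos j
    have h3 := hb x
    nlinarith

/-- A theorem of alternatives for the semidefinite program with positive costs `s`. -/
theorem exists_psd_or_exists_certificate (A : ι → α → α → ℝ) (s : ι → ℝ) (hs : ∀ j, 0 < s j)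
    (b : α → α → ℝ) (t : ℝ) :
    (∃ X : ι → Matrix α α ℝ, (∀ j, (X j).PosSemidef) ∧
      (∀ x y, ∑ j, A j x y * X j x y = b x y) ∧ ∀ x, ∑ j, s j * X j x x ≤ t) ∨
    (∃ (G : α → α → ℝ) (β : α → ℝ), (∀ x, 0 ≤ β x) ∧
      (∀ j (v : α → ℝ), ∑ x, ∑ y, A j x y * G x y * (v x * v y) ≤ s j * ∑ x, β x * v x ^ 2) ∧
      t * ∑ x, β x < ∑ x, ∑ y, b x y * G x y) := by
  classical
  set z : (α × α) ⊕ α → ℝ := Sum.elim (fun q => b q.1 q.2) (fun _ => t) with hz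
  by_cases hmem : z ∈ constraintMap A s '' psdCone α ι
  · obtain ⟨p, hp, he⟩ := hmem
    refine Or.inl ⟨fun j => Matrix.of (p.1 j), hp.1, fun x y => ?_, fun x => ?_⟩
    · exact congrFun he (Sum.inl (x, y))
    · have h1 : ∑ j, s j * p.1 j x x + p.2 x = t := congrFun he (Sum.inr x)
      have h2 := hp.2 x
      simp only [Matrix.of_apply]
      linarith
  · refine Or.inr ?_
    obtain ⟨φ, u, hφ, hu⟩ := geometric_hahn_banach_closed_point
      (convex_psdCone.linear_image (constraintMap A s))
      (isClosed_image_constraintMap A s hs) hmem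
    have hu0 : 0 < u := by
      have := hφ 0 ⟨0, ⟨fun j => Matrix.PosSemidef.zero, fun x => le_rfl⟩, map_zero _⟩
      simpa using this
    -- A positive value on the cone could be rescaled to equal `u`, against the strict bound.
    have hle : ∀ p ∈ psdCone α ι, φ (constraintMap A s p) ≤ 0 := by
      intro p hp
      by_contra! h
      have := hφ _ ⟨(u / φ (constraintMap A s p)) • p,
        smul_mem_psdCone hp (div_nonneg hu0.le h.le), rfl⟩
      rw [map_smul, map_smul, smul_eq_mul, div_mul_cancel₀ _ h.ne'] at this
      exact lt_irrefl _ this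
    set G : α → α → ℝ := fun x y => φ (Pi.single (Sum.inl (x, y)) 1) with hG
    set β : α → ℝ := fun x => -φ (Pi.single (Sum.inr x) 1) with hβ
    have hform : ∀ g : (α × α) ⊕ α → ℝ, φ g =
        ∑ x, ∑ y, g (Sum.inl (x, y)) * G x y - ∑ x, β x * g (Sum.inr x) := by
      intro g
      have := LinearMap.pi_apply_eq_sum_univ (φ : ((α × α) ⊕ α → ℝ) →ₗ[ℝ] ℝ) g
      simp only [ContinuousLinearMap.coe_coe] at this
      rw [this, Fintype.sum_sum_type, Fintype.sum_prod_type, sub_eq_add_neg,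
        ← Finset.sum_neg_distrib]
      have he : ∀ i : (α × α) ⊕ α, (fun j => if i = j then (1 : ℝ) else 0) = Pi.single i (1 : ℝ) := by
        intro i
        ext j
        simp [Pi.single_apply, eq_comm]
      simp only [he, smul_eq_mul, hG, hβ]
      congr 1
      exact Finset.sum_congr rfl fun x _ => by ring
    refine ⟨G, β, fun x => ?_, fun j v => ?_, ?_⟩
    · have h := hle (0, Pi.single x 1) ⟨fun j => Matrix.PosSemidef.zero, fun y => by
        by_cases h : y = x <;> simp [h]⟩
      rw [hform] at h
      simpa [constraintMap, Pi.single_apply] using h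
    -- The rank-one matrix `v vᵀ` in block `j`, with zero slack, tests the functional.
    · have hv : (Matrix.vecMulVec v v).PosSemidef := by
        simpa using Matrix.posSemidef_vecMulVec_self_star v
      set F : ι → α → α → ℝ := fun i x y => if i = j then v x * v y else 0 with hF
      have h := hle (F, 0) ⟨fun i => by
        by_cases h : i = j
        · simp only [hF, h, if_true]
          exact hv
        · simp only [hF, h, if_false]
          exact Matrix.PosSemidef.zero, fun y => le_rfl⟩
      rw [hform] at h
      have hA : ∀ x y, constraintMap A s (F, 0) (Sum.inl (x, y)) = A j x y * (v x * v y) := by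
        intro x y
        simp [constraintMap, hF]
      have hB : ∀ x, constraintMap A s (F, 0) (Sum.inr x) = s j * (v x * v x) := by
        intro x
        simp [constraintMap, hF]
      simp only [hA, hB] at h
      rw [Finset.mul_sum]
      have e1 : ∀ x y, A j x y * G x y * (v x * v y) = A j x y * (v x * v y) * G x y :=
        fun x y => by ring
      have e2 : ∀ x, s j * (β x * v x ^ 2) = β x * (s j * (v x * v x)) := fun x => by ring
      simp only [e1, e2]
      linarith
    · have h : 0 < φ z := hu0.trans hu
      rw [hform] at h
      simp only [hz, Sum.elim_inl, Sum.elim_inr] at h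
      rw [mul_comm, Finset.sum_mul]
      linarith

end Duality

/-! ### Weak duality -/

section Adversary

variable {n : ℕ} {C E : Type*} {D : Finset (Fin n → C)}

lemma dualObjective_term_nonneg {𝕜 : Type*} [RCLike 𝕜] {s : Fin n → ℝ} (hs : ∀ j, 0 ≤ s j)
    {X : Matrix (D × Fin n) (D × Fin n) 𝕜} (hX : X.PosSemidef) (x : D) :
    0 ≤ ∑ j, s j * RCLike.re (X (x, j) (x, j)) :=
  Finset.sum_nonneg fun j _ => mul_nonneg (hs j) (RCLike.nonneg_iff.1 hX.diag_nonneg).1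

lemma dualObjective_nonneg {𝕜 : Type*} [RCLike 𝕜] {s : Fin n → ℝ} (hs : ∀ j, 0 ≤ s j)
    {X : Matrix (D × Fin n) (D × Fin n) 𝕜} (hX : X.PosSemidef) : 0 ≤ dualObjective s X :=
  Real.iSup_nonneg fun x => dualObjective_term_nonneg hs hX x

lemma le_dualObjective {𝕜 : Type*} [RCLike 𝕜] (s : Fin n → ℝ)
    (X : Matrix (D × Fin n) (D × Fin n) 𝕜) (x : D) :
    ∑ j, s j * RCLike.re (X (x, j) (x, j)) ≤ dualObjective s X :=
  le_ciSup (f := fun x : D => ∑ j, s j * RCLike.re (X (x, j) (x, j)))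
    (Set.finite_range _).bddAbove x

lemma Matrix.PosSemidef.exists_apply_eq_sum {α : Type*} [Fintype α] [DecidableEq α]
    {X : Matrix α α ℝ} (hX : X.PosSemidef) :
    ∃ (m : ℕ) (B : Fin m → α → ℝ), ∀ p q, X p q = ∑ k, B k p * B k q := by
  obtain ⟨m, B, hB⟩ := Matrix.posSemidef_iff_eq_sum_vecMulVec.mp hX
  refine ⟨m, B, fun p q => ?_⟩
  simp [hB, Matrix.sum_apply, Matrix.vecMulVec_apply]

variable [DecidableEq C]

/-- The feasible set of the primal problem, in which the zero matrix is admitted. -/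
def IsPrimalFeasible (f : D → E) (s : Fin n → ℝ) (Γ : Matrix D D ℝ) : Prop :=
  Γ.IsSymm ∧ (∀ x y : D, f x = f y → Γ x y = 0) ∧
    ∀ j, matrixOpNorm (Matrix.hadamard Γ (deltaMatrix D j)) ≤ s j

lemma mem_advPMValues_iff {f : D → E} {s : Fin n → ℝ} {r : ℝ} :
    r ∈ advPMValues f s ↔ ∃ Γ : Matrix D D ℝ, Γ ≠ 0 ∧ IsPrimalFeasible f s Γ ∧
      r = matrixOpNorm Γ := by
  simp only [advPMValues, IsAdversaryMatrix, IsPrimalFeasible, Set.mem_ofPred_eq, and_assoc]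

lemma deltaMatrix_isSymm (j : Fin n) : (deltaMatrix D j).IsSymm := by
  ext x y
  simp [deltaMatrix, eq_comm]

lemma hadamard_deltaMatrix_isSymm {Γ : Matrix D D ℝ} (hΓ : Γ.IsSymm) (j : Fin n) :
    (Matrix.hadamard Γ (deltaMatrix D j)).IsSymm := by
  ext x y
  simp [hΓ.apply x y, (deltaMatrix_isSymm (D := D) j).apply x y]

/-- Weak duality for real matrices. -/
theorem opNorm_le_dualObjective_real {f : D → E} {s : Fin n → ℝ} (hs : ∀ j, 0 ≤ s j)
    {Γ : Matrix D D ℝ} (hΓ : IsPrimalFeasible f s Γ)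
    {X : Matrix (D × Fin n) (D × Fin n) ℝ} (hX : IsDualFeasible f X) :
    matrixOpNorm Γ ≤ dualObjective s X := by
  obtain ⟨hsymm, hzero, hbound⟩ := hΓ
  obtain ⟨m, B, hXe⟩ := hX.1.exists_apply_eq_sum
  refine opNorm_le_of_abs_quadForm_le Γ hsymm _ (dualObjective_nonneg hs hX.1) fun v => ?_
  have h1 : ∀ x y : D, Γ x y =
      ∑ j, Matrix.hadamard Γ (deltaMatrix D j) x y * X (x, j) (y, j) := by
    intro x y
    by_cases h : f x = f y
    · simp [hzero x y h]
    · have h2 := hX.2 x y h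
      rw [Finset.sum_filter] at h2
      calc Γ x y = Γ x y * 1 := (mul_one _).symm
        _ = _ := by
          rw [← h2, Finset.mul_sum]
          refine Finset.sum_congr rfl fun j _ => ?_
          by_cases hj : x.1 j = y.1 j <;> simp [deltaMatrix, hj]
  have h2 : ∑ x, ∑ y, Γ x y * (v x * v y) = ∑ j, ∑ k, ∑ x, ∑ y,
      Matrix.hadamard Γ (deltaMatrix D j) x y * ((v x * B k (x, j)) * (v y * B k (y, j))) := by
    have : ∀ x y, Γ x y * (v x * v y) = ∑ j, ∑ k, Matrix.hadamard Γ (deltaMatrix D j) x y *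
        ((v x * B k (x, j)) * (v y * B k (y, j))) := by
      intro x y
      rw [h1, Finset.sum_mul]
      refine Finset.sum_congr rfl fun j _ => ?_
      rw [hXe, Finset.mul_sum, Finset.sum_mul]
      exact Finset.sum_congr rfl fun k _ => by ring
    simp only [this]
    calc _ = ∑ x, ∑ j, ∑ y, ∑ k, Matrix.hadamard Γ (deltaMatrix D j) x y *
          ((v x * B k (x, j)) * (v y * B k (y, j))) :=
          Finset.sum_congr rfl fun x _ => Finset.sum_comm
      _ = ∑ j, ∑ x, ∑ k, ∑ y, Matrix.hadamard Γ (deltaMatrix D j) x y *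
          ((v x * B k (x, j)) * (v y * B k (y, j))) := by
          rw [Finset.sum_comm]
          exact Finset.sum_congr rfl fun j _ => Finset.sum_congr rfl fun x _ => Finset.sum_comm
      _ = _ := Finset.sum_congr rfl fun j _ => Finset.sum_comm
  have h3 : ∑ j, ∑ k, s j * ∑ x, (v x * B k (x, j)) ^ 2 =
      ∑ x, v x ^ 2 * ∑ j, s j * X (x, j) (x, j) := by
    calc _ = ∑ j, ∑ x, v x ^ 2 * (s j * X (x, j) (x, j)) := by
          refine Finset.sum_congr rfl fun j _ => ?_
          rw [← Finset.mul_sum, Finset.sum_comm, Finset.mul_sum]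
          refine Finset.sum_congr rfl fun x _ => ?_
          rw [hXe, Finset.mul_sum, Finset.mul_sum, Finset.mul_sum]
          exact Finset.sum_congr rfl fun k _ => by ring
      _ = _ := by
          rw [Finset.sum_comm]
          exact Finset.sum_congr rfl fun x _ => (Finset.mul_sum _ _ _).symm
  rw [h2]
  calc _ ≤ ∑ j, ∑ k, s j * ∑ x, (v x * B k (x, j)) ^ 2 := by
        refine (Finset.abs_sum_le_sum_abs _ _).trans (Finset.sum_le_sum fun j _ => ?_)
        refine (Finset.abs_sum_le_sum_abs _ _).trans (Finset.sum_le_sum fun k _ => ?_)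
        refine (abs_quadForm_le_opNorm (Matrix.hadamard Γ (deltaMatrix D j))
          (fun x => v x * B k (x, j))).trans ?_
        exact mul_le_mul_of_nonneg_right (hbound j) (Finset.sum_nonneg fun x _ => sq_nonneg _)
    _ = _ := h3
    _ ≤ ∑ x, v x ^ 2 * dualObjective s X := by
        refine Finset.sum_le_sum fun x _ => mul_le_mul_of_nonneg_left ?_ (sq_nonneg _)
        simpa using le_dualObjective s X x
    _ = _ := by rw [← Finset.sum_mul, mul_comm]

/-- The entry-wise real part of a positive semidefinite matrix is positive semidefinite. -/
lemma posSemidef_map_re {𝕜 α : Type*} [RCLike 𝕜] [Fintype α] {X : Matrix α α 𝕜}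
    (hX : X.PosSemidef) : (X.map RCLike.re : Matrix α α ℝ).PosSemidef := by
  rw [posSemidef_real_iff]
  refine ⟨?_, fun v => ?_⟩
  · ext x y
    have := congrArg RCLike.re (hX.1.apply x y)
    simpa using this
  · have h := (RCLike.nonneg_iff.1 (hX.dotProduct_mulVec_nonneg fun x => (v x : 𝕜))).1
    simp only [dotProduct, Matrix.mulVec, Pi.star_apply, RCLike.star_def, RCLike.conj_ofReal,
      map_sum, RCLike.re_ofReal_mul, mul_comm _ ((v _ : ℝ) : 𝕜), Finset.mul_sum] at h
    refine h.trans_eq (Finset.sum_congr rfl fun x _ => Finset.sum_congr rfl fun y _ => ?_)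
    simp only [Matrix.map_apply]
    ring

lemma posSemidef_map_ofReal {𝕜 α : Type*} [RCLike 𝕜] [Fintype α] [DecidableEq α]
    {X : Matrix α α ℝ} (hX : X.PosSemidef) :
    (X.map (fun r : ℝ => (r : 𝕜))).PosSemidef := by
  obtain ⟨m, B, hB⟩ := hX.exists_apply_eq_sum
  have : X.map (fun r : ℝ => (r : 𝕜)) =
      (Matrix.of fun k p => (B k p : 𝕜)).conjTranspose * Matrix.of fun k p => (B k p : 𝕜) := by
    ext x y
    simp [hB, Matrix.mul_apply]
  rw [this]
  exact Matrix.posSemidef_conjTranspose_mul_self _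

/-- Taking real parts preserves feasibility, since the right-hand sides are real, and leaves the
objective unchanged. -/
theorem opNorm_le_dualObjective {𝕜 : Type*} [RCLike 𝕜] {f : D → E} {s : Fin n → ℝ}
    (hs : ∀ j, 0 ≤ s j) {Γ : Matrix D D ℝ} (hΓ : IsPrimalFeasible f s Γ)
    {X : Matrix (D × Fin n) (D × Fin n) 𝕜} (hX : IsDualFeasible f X) :
    matrixOpNorm Γ ≤ dualObjective s X := by
  have hre : IsDualFeasible f (X.map RCLike.re : Matrix (D × Fin n) (D × Fin n) ℝ) := by
    refine ⟨posSemidef_map_re hX.1, fun x y h => ?_⟩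
    have := congrArg RCLike.re (hX.2 x y h)
    simpa using this
  simpa [dualObjective] using opNorm_le_dualObjective_real hs hΓ hre

lemma isDualFeasible_map_ofReal {𝕜 : Type*} [RCLike 𝕜] {f : D → E}
    {X : Matrix (D × Fin n) (D × Fin n) ℝ} (hX : IsDualFeasible f X) :
    IsDualFeasible f (X.map (fun r : ℝ => (r : 𝕜))) := by
  refine ⟨posSemidef_map_ofReal hX.1, fun x y h => ?_⟩
  have := congrArg (fun r : ℝ => (r : 𝕜)) (hX.2 x y h)
  simpa using this

end Adversary

/-! ### Strong duality -/

section Adversary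

variable {n : ℕ} {C E : Type*} {D : Finset (Fin n → C)}

lemma posSemidef_blockDiagonal_real {α ι : Type*} [Fintype α] [Fintype ι] [DecidableEq ι]
    {Y : ι → Matrix α α ℝ} (hY : ∀ j, (Y j).PosSemidef) :
    (Matrix.blockDiagonal Y).PosSemidef := by
  rw [posSemidef_real_iff]
  refine ⟨?_, fun v => ?_⟩
  · rw [Matrix.IsSymm, Matrix.blockDiagonal_transpose]
    exact congrArg _ (funext fun j => ((posSemidef_real_iff _).1 (hY j)).1)
  · have : ∑ p, ∑ q, Matrix.blockDiagonal Y p q * (v p * v q) =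
        ∑ j, ∑ x, ∑ y, Y j x y * (v (x, j) * v (y, j)) := by
      simp only [Fintype.sum_prod_type, Matrix.blockDiagonal_apply, ite_mul, zero_mul,
        Finset.sum_ite_eq, Finset.mem_univ, if_true]
      exact Finset.sum_comm
    rw [this]
    exact Finset.sum_nonneg fun j _ => ((posSemidef_real_iff _).1 (hY j)).2 fun x => v (x, j)

/-- A symmetric matrix becomes positive semidefinite after adding a large multiple of the
identity. -/
lemma exists_posSemidef_add_smul_one {α : Type*} [Fintype α] [DecidableEq α] (M : Matrix α α ℝ)
    (hM : M.IsSymm) : ∃ c : ℝ, (M + c • (1 : Matrix α α ℝ)).PosSemidef := by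
  refine ⟨‖Matrix.toEuclideanCLM (n := α) (𝕜 := ℝ) M‖, (posSemidef_real_iff _).2 ⟨?_, fun v => ?_⟩⟩
  · simp [Matrix.IsSymm, hM.eq]
  · have h := (abs_le.1 (abs_quadForm_le_opNorm M v)).1
    have h2 : ∀ c : ℝ, ∑ x, ∑ y, (M + c • (1 : Matrix α α ℝ)) x y * (v x * v y) =
        ∑ x, ∑ y, M x y * (v x * v y) + c * ∑ x, v x ^ 2 := by
      intro c
      simp only [Matrix.add_apply, add_mul, Finset.sum_add_distrib, Matrix.smul_apply,
        Matrix.one_apply, smul_eq_mul, mul_ite, mul_one, mul_zero, ite_mul, zero_mul,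
        Finset.sum_ite_eq, Finset.mem_univ, if_true, Finset.mul_sum]
      congr 1
      exact Finset.sum_congr rfl fun x _ => by ring
    rw [h2]
    linarith

lemma exists_sign_of_card_eq_two {α T : Type*} (g : α → T) (hT : Nat.card T = 2) :
    ∃ σ : α → ℝ, (∀ x, σ x ^ 2 = 1) ∧ ∀ x y, g x ≠ g y → σ x * σ y = -1 := by
  classical
  obtain ⟨a, b, hab, huniv⟩ := Nat.card_eq_two_iff.1 hT
  refine ⟨fun x => if g x = a then 1 else -1, fun x => ?_, fun x y hxy => ?_⟩
  · dsimp only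
    split_ifs <;> norm_num
  · have hx : g x = a ∨ g x = b := by simpa [← huniv] using Set.mem_univ (g x)
    have hy : g y = a ∨ g y = b := by simpa [← huniv] using Set.mem_univ (g y)
    rcases hx with hx | hx <;> rcases hy with hy | hy <;> simp [hx, hy, hab.symm] at hxy ⊢

/-- If the inputs, or the outputs, are binary, then the pairs with different outputs that differ
at `j` form a bipartite graph. -/
lemma exists_sign (f : D → E) (hbin : Nat.card C = 2 ∨ Nat.card E = 2) (j : Fin n) :
    ∃ σ : D → ℝ, (∀ x, σ x ^ 2 = 1) ∧
      ∀ x y : D, x.1 j ≠ y.1 j → f x ≠ f y → σ x * σ y = -1 := by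
  rcases hbin with h | h
  · obtain ⟨σ, h1, h2⟩ := exists_sign_of_card_eq_two (fun x : D => x.1 j) h
    exact ⟨σ, h1, fun x y hxy _ => h2 x y hxy⟩
  · obtain ⟨σ, h1, h2⟩ := exists_sign_of_card_eq_two f h
    exact ⟨σ, h1, fun x y _ hxy => h2 x y hxy⟩

variable [DecidableEq C]

/-- Completing a family of blocks for the positive costs to a dual feasible matrix, at no cost. -/
lemma exists_isDualFeasible_extension (f : D → E) (s : Fin n → ℝ)
    (X : {j // 0 < s j} → Matrix D D ℝ) (hX : ∀ j, (X j).PosSemidef)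
    (hX1 : ∀ x y : D, f x ≠ f y → (∀ j, ¬ 0 < s j → x.1 j = y.1 j) →
      ∑ j : {j // 0 < s j}, (if x.1 j ≠ y.1 j then X j x y else 0) = 1) :
    ∃ Z : Matrix (D × Fin n) (D × Fin n) ℝ, IsDualFeasible f Z ∧
      ∀ (x : D) (j : {j // 0 < s j}), Z (x, j) (x, j) = X j x x := by
  classical
  -- `R` is what the positive-cost blocks leave unmet in each constraint; it is shared equally among
  -- the `N` zero-cost coordinates where `x` and `y` differ.
  set R : D → D → ℝ := fun x y =>
    1 - ∑ j : {j // 0 < s j}, (if x.1 j ≠ y.1 j then X j x y else 0) with hR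
  set N : D → D → ℕ := fun x y =>
    (Finset.univ.filter fun j : {j // ¬ 0 < s j} => x.1 j ≠ y.1 j).card with hN
  have hXs : ∀ j x y, X j y x = X j x y := fun j x y =>
    ((posSemidef_real_iff _).1 (hX j)).1.apply x y
  have hRs : ∀ x y, R y x = R x y := by
    intro x y
    simp only [hR, ne_comm, hXs]
  have hNs : ∀ x y, N y x = N x y := by
    intro x y
    simp only [hN]
    congr 2
    ext j
    exact ne_comm
  set M : Fin n → Matrix D D ℝ := fun j => Matrix.of fun x y =>
    if x.1 j ≠ y.1 j then R x y / N x y else 0 with hM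
  have hMs : ∀ j, (M j).IsSymm := by
    intro j
    ext x y
    simp [hM, hRs x y, hNs x y, eq_comm]
  choose c hc using fun j => exists_posSemidef_add_smul_one (M j) (hMs j)
  -- The multiple of the identity restores positivity without touching the constraints, which
  -- concern only `x ≠ y`.
  set Y : Fin n → Matrix D D ℝ := fun j =>
    if h : 0 < s j then X ⟨j, h⟩ else M j + c j • (1 : Matrix D D ℝ) with hY
  have hY1 : ∀ j : {j // 0 < s j}, Y j = X j := fun j => by simp [hY, j.2]
  have hY2 : ∀ j : {j // ¬ 0 < s j}, Y j = M j + c j • (1 : Matrix D D ℝ) := fun j => by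
    simp only [hY, dif_neg j.2]
  refine ⟨Matrix.blockDiagonal Y, ⟨posSemidef_blockDiagonal_real fun j => ?_, fun x y hxy => ?_⟩,
    fun x j => ?_⟩
  · by_cases h : 0 < s j
    · simpa [hY, h] using hX ⟨j, h⟩
    · simpa only [hY, dif_neg h] using hc j
  · have hne : x ≠ y := fun h => hxy (congrArg f h)
    simp only [Matrix.blockDiagonal_apply, if_true]
    rw [Finset.sum_filter, ← Fintype.sum_subtype_add_sum_subtype (fun j => 0 < s j)]
    have e2 : ∀ j : {j // ¬ 0 < s j}, (if x.1 j ≠ y.1 j then Y j x y else 0) =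
        if x.1 j ≠ y.1 j then R x y / N x y else 0 := by
      intro j
      rw [hY2]
      split_ifs with h <;> simp [hM, h, Matrix.one_apply_ne hne]
    simp only [hY1]
    have e3 : ∑ j : {j // ¬ 0 < s j}, (if x.1 j ≠ y.1 j then Y j x y else 0) =
        N x y * (R x y / N x y) := by
      rw [Finset.sum_congr rfl fun j _ => e2 j, ← Finset.sum_filter, Finset.sum_const,
        nsmul_eq_mul]
    rw [e3]
    by_cases h0 : N x y = 0
    · have hz : ∀ j, ¬ 0 < s j → x.1 j = y.1 j := by
        intro j hj
        by_contra hne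
        exact Finset.notMem_empty _ ((Finset.card_eq_zero.1 h0) ▸
          Finset.mem_filter.2 ⟨Finset.mem_univ (⟨j, hj⟩ : {j // ¬ 0 < s j}), hne⟩)
      rw [hX1 x y hxy hz, h0]
      simp
    · rw [mul_div_cancel₀ _ (Nat.cast_ne_zero.2 h0)]
      simp [hR]
  · simp [Matrix.blockDiagonal_apply, hY1]

/-- A certificate of infeasibility for the dual yields an adversary matrix. -/
lemma exists_isPrimalFeasible_of_certificate (f : D → E) (s : Fin n → ℝ) (hs : ∀ j, 0 ≤ s j)
    (hbin : Nat.card C = 2 ∨ Nat.card E = 2) (Γ : Matrix D D ℝ) (hΓ : Γ.IsSymm)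
    (h0 : ∀ x y, f x = f y → Γ x y = 0) (β : D → ℝ) (hβ : ∀ x, 0 ≤ β x)
    (hq : ∀ j (v : D → ℝ), ∑ x, ∑ y, Matrix.hadamard Γ (deltaMatrix D j) x y * (v x * v y) ≤
      s j * ∑ x, β x * v x ^ 2) (t : ℝ) (ht : t * ∑ x, β x < ∑ x, ∑ y, Γ x y) :
    ∃ Γ' : Matrix D D ℝ, IsPrimalFeasible f s Γ' ∧ t < matrixOpNorm Γ' := by
  classical
  -- If `β x = 0`, the coefficient at `x` is free on the right-hand side; it is chosen so that the
  -- left-hand side is `s j * β y + 1`.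
  have hvan : ∀ x y, β x = 0 → Γ x y = 0 := by
    intro x y hx
    by_contra hne
    have hxy : x ≠ y := fun h => hne (h0 x y (congrArg f h))
    obtain ⟨j, hj⟩ : ∃ j, x.1 j ≠ y.1 j := Function.ne_iff.1 fun h => hxy (Subtype.ext h)
    have h := hq j (Pi.single x ((s j * β y + 1) / (2 * Γ x y)) + Pi.single y 1)
    rw [quadForm_single_add_single _ (hadamard_deltaMatrix_isSymm hΓ j)] at h
    have hsum : ∑ z, β z * (Pi.single x ((s j * β y + 1) / (2 * Γ x y)) +
        Pi.single y 1 : D → ℝ) z ^ 2 = β y := by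
      rw [Finset.sum_eq_single y _ (by simp)]
      · simp [hxy.symm]
      · intro z _ hz
        by_cases hzx : z = x
        · simp [hzx, hx]
        · simp [hz, hzx]
    rw [hsum] at h
    simp only [Matrix.hadamard_apply, deltaMatrix, Matrix.of_apply, ne_eq, not_true_eq_false,
      if_false, hj, not_false_eq_true, if_true, mul_zero, zero_mul, mul_one, add_zero, zero_add]
      at h
    rw [mul_div_cancel₀ _ (mul_ne_zero two_ne_zero hne)] at h
    linarith
  -- Replacing `v` by `σ v` negates the form, so the upper bound is also a lower bound.
  have habs : ∀ j (v : D → ℝ),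
      |∑ x, ∑ y, Matrix.hadamard Γ (deltaMatrix D j) x y * (v x * v y)| ≤
      s j * ∑ x, β x * v x ^ 2 := by
    intro j v
    obtain ⟨σ, hσ, hσ2⟩ := exists_sign f hbin j
    have h := hq j (fun x => σ x * v x)
    simp only [mul_pow, hσ, one_mul] at h
    have e : ∀ x y, Matrix.hadamard Γ (deltaMatrix D j) x y * (σ x * v x * (σ y * v y)) =
        -(Matrix.hadamard Γ (deltaMatrix D j) x y * (v x * v y)) := by
      intro x y
      by_cases hf : f x = f y
      · simp [h0 x y hf]
      by_cases hj : x.1 j = y.1 j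
      · simp [deltaMatrix, hj]
      · rw [show σ x * v x * (σ y * v y) = (σ x * σ y) * (v x * v y) by ring, hσ2 x y hj hf]
        ring
    simp only [e, Finset.sum_neg_distrib] at h
    exact abs_le.2 ⟨by linarith, hq j v⟩
  -- Where `β` vanishes, division by zero gives `0`; by `hvan` no entry of `Γ` is lost.
  set Γ' : Matrix D D ℝ := Matrix.of fun x y => Γ x y / (√(β x) * √(β y)) with hΓ'
  have hsymm : Γ'.IsSymm := by
    ext x y
    simp [hΓ', hΓ.apply x y, mul_comm]
  refine ⟨Γ', ⟨hsymm, fun x y h => by simp [hΓ', h0 x y h], fun j => ?_⟩, ?_⟩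
  · refine opNorm_le_of_abs_quadForm_le _ (hadamard_deltaMatrix_isSymm hsymm j) _ (hs j)
      fun v => ?_
    have h := habs j (fun x => v x / √(β x))
    have e : ∀ x y, Matrix.hadamard Γ (deltaMatrix D j) x y * (v x / √(β x) * (v y / √(β y))) =
        Matrix.hadamard Γ' (deltaMatrix D j) x y * (v x * v y) := by
      intro x y
      simp only [Matrix.hadamard_apply, hΓ', Matrix.of_apply]
      ring
    simp only [e] at h
    refine h.trans (mul_le_mul_of_nonneg_left (Finset.sum_le_sum fun x _ => ?_) (hs j))
    rw [div_pow, Real.sq_sqrt (hβ x)]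
    rcases eq_or_ne (β x) 0 with hz | hz
    · simpa [hz] using sq_nonneg (v x)
    · rw [mul_div_cancel₀ _ hz]
  · by_contra! hle
    -- At the vector `√β` the form of `Γ'` is `∑ Γ`, and the squared norm is `∑ β`.
    have h := (le_abs_self _).trans (abs_quadForm_le_opNorm Γ' fun x => √(β x))
    have e : ∀ x y, Γ' x y * (√(β x) * √(β y)) = Γ x y := by
      intro x y
      by_cases hz : √(β x) * √(β y) = 0
      · rw [hz, mul_zero]
        rcases mul_eq_zero.1 hz with hz | hz
        · exact (hvan x y ((Real.sqrt_eq_zero (hβ x)).1 hz)).symm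
        · rw [← hΓ.apply x y]
          exact (hvan y x ((Real.sqrt_eq_zero (hβ y)).1 hz)).symm
      · exact div_mul_cancel₀ _ hz
    simp only [e, Real.sq_sqrt (hβ _)] at h
    have h2 : matrixOpNorm Γ' * ∑ x, β x ≤ t * ∑ x, β x :=
      mul_le_mul_of_nonneg_right hle (Finset.sum_nonneg fun x _ => hβ x)
    exact absurd (h.trans h2) (not_le.2 ht)

/-- Strong duality: a bound on the primal problem is attained by a dual feasible matrix. -/
theorem exists_isDualFeasible_le (f : D → E) (s : Fin n → ℝ) (hs : ∀ j, 0 ≤ s j)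
    (hbin : Nat.card C = 2 ∨ Nat.card E = 2) (t : ℝ)
    (ht : ∀ Γ : Matrix D D ℝ, IsPrimalFeasible f s Γ → matrixOpNorm Γ ≤ t) :
    ∃ X : Matrix (D × Fin n) (D × Fin n) ℝ, IsDualFeasible f X ∧
      ∀ x, ∑ j, s j * X (x, j) (x, j) ≤ t := by
  classical
  -- Only pairs agreeing at all zero-cost coordinates constrain the positive-cost blocks. As a
  -- factor of the coefficients too, `b` makes every other equation read `0 = 0`.
  set b : D → D → ℝ := fun x y =>
    if f x ≠ f y ∧ ∀ j, ¬ 0 < s j → x.1 j = y.1 j then 1 else 0 with hb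
  have hbs : ∀ x y, b y x = b x y := fun x y => by simp only [hb, ne_comm, eq_comm]
  rcases exists_psd_or_exists_certificate
    (fun (j : {j // 0 < s j}) x y => b x y * deltaMatrix D j.1 x y) (fun j => s j.1)
    (fun j => j.2) b t with ⟨X, hX, hX1, hX2⟩ | ⟨G, β, hβ, hq, hlt⟩
  · obtain ⟨Z, hZ, hZX⟩ := exists_isDualFeasible_extension f s X hX fun x y hxy hz => by
      have h := hX1 x y
      have hbe : b x y = 1 := if_pos ⟨hxy, hz⟩
      simpa [hbe, deltaMatrix] using h
    refine ⟨Z, hZ, fun x => ?_⟩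
    rw [← Fintype.sum_subtype_add_sum_subtype (fun j => 0 < s j)]
    have h0 : ∑ j : {j // ¬ 0 < s j}, s j * Z (x, j) (x, j) = 0 :=
      Finset.sum_eq_zero fun j _ => by
        rw [le_antisymm (not_lt.1 j.2) (hs j), zero_mul]
    simp only [hZX, h0, add_zero]
    exact hX2 x
  · exfalso
    -- The separating functional need not be symmetric; symmetrizing `G` does not change its pairing
    -- with symmetric `g`.
    have hswap : ∀ (g : D → D → ℝ), (∀ x y, g y x = g x y) →
        ∑ x, ∑ y, g x y * ((G x y + G y x) / 2) = ∑ x, ∑ y, g x y * G x y := by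
      intro g hg
      have h1 : ∑ x, ∑ y, g x y * G y x = ∑ x, ∑ y, g x y * G x y := by
        rw [Finset.sum_comm]
        simp only [hg]
      have h2 : ∀ x y, g x y * ((G x y + G y x) / 2) =
          (g x y * G x y) / 2 + (g x y * G y x) / 2 := fun x y => by ring
      simp only [h2, Finset.sum_add_distrib, ← Finset.sum_div, h1]
      ring
    obtain ⟨Γ', hΓ', hlt'⟩ := exists_isPrimalFeasible_of_certificate f s hs hbin
      (Matrix.of fun x y => b x y * ((G x y + G y x) / 2))
      (by ext x y; simp [hbs x y, add_comm]) (fun x y h => by simp [hb, h]) β hβ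
      (fun j v => by
        by_cases hj : 0 < s j
        · refine Eq.trans_le ?_ (hq ⟨j, hj⟩ v)
          have := hswap (fun x y => b x y * deltaMatrix D j x y * (v x * v y)) fun x y => by
            rw [hbs, (deltaMatrix_isSymm j).apply x y, mul_comm (v y)]
          refine Eq.trans ?_ (this.trans ?_) <;>
          · refine Finset.sum_congr rfl fun x _ => Finset.sum_congr rfl fun y _ => ?_
            simp only [Matrix.hadamard_apply, Matrix.of_apply]
            ring
        -- At zero cost the form vanishes: `b` is zero on pairs that differ at `j`.
        · refine (Finset.sum_nonpos fun x _ => Finset.sum_nonpos fun y _ => ?_).trans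
            (mul_nonneg (hs j) (Finset.sum_nonneg fun x _ => mul_nonneg (hβ x) (sq_nonneg _)))
          by_cases hxy : x.1 j = y.1 j
          · simp [deltaMatrix, hxy]
          · have : b x y = 0 := if_neg fun h => hxy (h.2 j hj)
            simp [this])
      t (hlt.trans_eq (hswap b hbs).symm)
    exact absurd (ht Γ' hΓ') (not_le.2 hlt')

/-! ### Attainment of the primal maximum and conclusion -/

lemma exists_isMax_primal (f : D → E) (s : Fin n → ℝ) (hs : ∀ j, 0 ≤ s j) :
    ∃ Γ₀ : Matrix D D ℝ, IsPrimalFeasible f s Γ₀ ∧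
      ∀ Γ, IsPrimalFeasible f s Γ → matrixOpNorm Γ ≤ matrixOpNorm Γ₀ := by
  classical
  have hcont : Continuous (fun Γ : Matrix D D ℝ => matrixOpNorm Γ) := by
    have : Continuous ((Matrix.toEuclideanCLM (n := D) (𝕜 := ℝ)).toAlgEquiv.toLinearMap) :=
      LinearMap.continuous_of_finiteDimensional _
    exact this.norm
  have hclosed : IsClosed {Γ : Matrix D D ℝ | IsPrimalFeasible f s Γ} := by
    simp only [IsPrimalFeasible, Matrix.IsSymm.ext_iff, Set.ofPred_and, Set.ofPred_forall]
    refine (isClosed_iInter fun x => isClosed_iInter fun y =>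
      isClosed_eq (by fun_prop) (by fun_prop)).inter ((isClosed_iInter fun x =>
      isClosed_iInter fun y => isClosed_iInter fun _ =>
      isClosed_eq (by fun_prop) (by fun_prop)).inter (isClosed_iInter fun j =>
      isClosed_le (hcont.comp ?_) continuous_const))
    refine continuous_matrix fun x y => ?_
    simp only [Matrix.hadamard_apply]
    fun_prop
  have hcompact : IsCompact {Γ : Matrix D D ℝ | IsPrimalFeasible f s Γ} := by
    -- Distinct inputs differ at some `j`, so each off-diagonal entry of `Γ` is an entry of some `Γ
    -- ∘ Δ_j`, hence at most `s_j` in absolute value.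
    have hK : IsCompact (Set.pi Set.univ fun _ : D => Set.pi Set.univ fun _ : D =>
        Set.Icc (-∑ j, s j) (∑ j, s j)) :=
      isCompact_univ_pi fun _ => isCompact_univ_pi fun _ => isCompact_Icc
    refine hK.of_isClosed_subset hclosed fun (Γ : Matrix D D ℝ) hΓ => ?_
    refine Set.mem_univ_pi.2 fun x => Set.mem_univ_pi.2 fun y => abs_le.1 (?_ : |Γ x y| ≤ _)
    have hsum : 0 ≤ ∑ j, s j := Finset.sum_nonneg fun j _ => hs j
    by_cases hxy : x = y
    · rw [hΓ.2.1 x y (congrArg f hxy), abs_zero]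
      exact hsum
    · obtain ⟨j, hj⟩ : ∃ j, x.1 j ≠ y.1 j := Function.ne_iff.1 fun h => hxy (Subtype.ext h)
      have h := (abs_apply_le_opNorm (Matrix.hadamard Γ (deltaMatrix D j)) x y).trans (hΓ.2.2 j)
      have he : Matrix.hadamard Γ (deltaMatrix D j) x y = Γ x y := by simp [deltaMatrix, hj]
      rw [he] at h
      exact h.trans (Finset.single_le_sum (fun j _ => hs j) (Finset.mem_univ j))
  obtain ⟨Γ₀, h0, hmax⟩ := hcompact.exists_isMaxOn
    ⟨0, by simp [Matrix.IsSymm], by simp, fun j => by simpa [matrixOpNorm] using hs j⟩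
    hcont.continuousOn
  exact ⟨Γ₀, h0, fun Γ hΓ => hmax hΓ⟩

lemma isGreatest_advPMValues {f : D → E} {s : Fin n → ℝ} {Γ₀ : Matrix D D ℝ}
    (h0 : IsPrimalFeasible f s Γ₀)
    (hmax : ∀ Γ, IsPrimalFeasible f s Γ → matrixOpNorm Γ ≤ matrixOpNorm Γ₀)
    (hne : (advPMValues f s).Nonempty) :
    IsGreatest (advPMValues f s) (matrixOpNorm Γ₀) := by
  have hpos : ∀ Γ : Matrix D D ℝ, matrixOpNorm Γ = 0 ↔ Γ = 0 := fun Γ => by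
    simp [matrixOpNorm]
  refine ⟨mem_advPMValues_iff.2 ⟨Γ₀, fun hz => ?_, h0, rfl⟩, ?_⟩
  · obtain ⟨r, hr⟩ := hne
    obtain ⟨Γ, hΓ0, hΓ, -⟩ := mem_advPMValues_iff.1 hr
    have h1 := hmax Γ hΓ
    rw [(hpos Γ₀).2 hz] at h1
    exact hΓ0 ((hpos Γ).1 (le_antisymm h1 (norm_nonneg _)))
  · intro r hr
    obtain ⟨Γ, -, hΓ, rfl⟩ := mem_advPMValues_iff.1 hr
    exact hmax Γ hΓ

lemma advPM_eq {f : D → E} {s : Fin n → ℝ} {Γ₀ : Matrix D D ℝ}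
    (h0 : IsPrimalFeasible f s Γ₀)
    (hmax : ∀ Γ, IsPrimalFeasible f s Γ → matrixOpNorm Γ ≤ matrixOpNorm Γ₀) :
    advPM f s = matrixOpNorm Γ₀ := by
  rcases (advPMValues f s).eq_empty_or_nonempty with he | hne
  -- With no nonzero feasible matrix, the value agrees with the convention `sSup ∅ = 0`.
  · have hz : Γ₀ = 0 := by
      by_contra hz
      have : matrixOpNorm Γ₀ ∈ advPMValues f s := mem_advPMValues_iff.2 ⟨Γ₀, hz, h0, rfl⟩
      simp [he] at this
    simp [advPM, he, hz, matrixOpNorm]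
  · exact (isGreatest_advPMValues h0 hmax hne).csSup_eq

end Adversary

theorem theoremt {𝕜 : Type*} [RCLike 𝕜] {n : ℕ} {C E : Type*} [DecidableEq C]
    (D : Finset (Fin n → C)) (f : D → E) (s : Fin n → ℝ) (hs : ∀ j, 0 ≤ s j)
    (hbin : Nat.card C = 2 ∨ Nat.card E = 2) :
    ((advPMValues f s).Nonempty → IsGreatest (advPMValues f s) (advPM f s)) ∧
    IsLeast (dualObjective s '' {X : Matrix (D × Fin n) (D × Fin n) 𝕜 | IsDualFeasible f X})
      (advPM f s) := by
  obtain ⟨Γ₀, h0, hmax⟩ := exists_isMax_primal f s hs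
  rw [advPM_eq h0 hmax]
  refine ⟨isGreatest_advPMValues h0 hmax, ?_, ?_⟩
  · obtain ⟨X, hX, hle⟩ := exists_isDualFeasible_le f s hs hbin _ hmax
    have hX' := isDualFeasible_map_ofReal (𝕜 := 𝕜) hX
    refine ⟨_, hX', le_antisymm ?_ (opNorm_le_dualObjective hs h0 hX')⟩
    -- The nonnegative bound also covers empty `D`, where the supremum is `0`.
    refine Real.iSup_le (fun x => ?_) (norm_nonneg _)
    simpa using hle x
  · rintro _ ⟨X, hX, rfl⟩
    exact opNorm_le_dualObjective hs h0 hX
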